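/- All Banach spaces are real. For a Banach space $X$, let $\dim X$ be the least cardinality of a subset of $X$ whose linear span is dense in $X$. For an isomorphic embedding $u:Y\to X$ (an isomorphism onto its range $uY$), $u^{-1}:uY\to Y$ denotes its inverse. A Banach space $Y$ is finitely representable in $X$ if for every $\varepsilon>0$ and every finite-dimensional subspace $A$ of $Y$ there is an isomorphic embedding $u:A\to X$ with $\|u\|\,\|u^{-1}\|\le 1+\varepsilon$. The class $X^{f}$ consists of all Banach spaces $Y$ such that $Y$ is finitely representable in $X$ and $X$ is finitely representable in $Y$. A Banach space $E$ is an envelope (of the class $E^{f}$) if every Banach space $Y$ that is finitely representable in $E$ and satisfies $\dim Y\le\dim E$ is isometric to a subspace of $E$. A Banach space $X$ is $f$-saturated if it is of almost universal disposition with respect to the class $\mathcal K$ of all Banach spaces $Y$ that are finitely representable in $X$ and satisfy $\dim Y<\dim X$, that is: whenever $A,B\in\mathcal K$, $A$ is a subspace of $B$, $\varepsilon>0$, and $i:A\to X$ is an isomorphic embedding, there is an isomorphic embedding $\tilde\imath:B\to X$ that extends $i$ and satisfies $\|\tilde\imath\|\,\|\tilde\imath^{-1}\|\le(1+\varepsilon)\,\|i\|\,\|i^{-1}\|$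 (for $A=\{0\}$ the product $\|i\|\,\|i^{-1}\|$ is read as $1$). It is isometrically $f$-saturated if this is required only for isometric embeddings $i$; every $f$-saturated space is isometrically $f$-saturated. A Banach space $X$ is stable if for all bounded sequences $(x_n)$, $(y_m)$ in $X$ and all ultrafilters $D$, $D'$ over $\mathbb N$, $$\lim_{D(n)}\lim_{D'(m)}\|x_n+y_m\|=\lim_{D'(m)}\lim_{D(n)}\|x_n+y_m\|;$$ it is superstable if each of its ultrapowers is stable. A class $X^{f}$ is superstable if each of its members is superstable. **Theorem.** Let $E$ be an envelope of the class $E^{f}$, where $E^{f}$ is not superstable, and suppose that $\dim E=\varkappa$ is a singular cardinal. Then $E$ is not $f$-saturated; indeed $E$ is not even isometrically $f$-saturated. -/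

import Mathlib

open Filter Topology
open scoped ENNReal

universe u

namespace FinEquiv

/-- `HasDistortionLE K T`: the bounded operator `T` is an isomorphic embedding with
`‖T‖ * ‖T⁻¹‖ ≤ K`, where `T⁻¹` is defined on the range of `T` (take `a = 1 / ‖T⁻¹‖`).
If the domain is the zero space, this holds for every `K`. -/
def HasDistortionLE {Y X : Type*} [NormedAddCommGroup Y] [NormedSpace ℝ Y]
    [NormedAddCommGroup X] [NormedSpace ℝ X] (K : ℝ) (T : Y →L[ℝ] X) : Prop :=
  ∃ a : ℝ, 0 < a ∧ ∀ y : Y, a * ‖y‖ ≤ ‖T y‖ ∧ ‖T y‖ ≤ K * a * ‖y‖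

/-- The dimension of a normed space: the least cardinality of a subset whose linear span is dense.
It is the algebraic dimension for finite-dimensional spaces and the density character for
infinite-dimensional ones. -/
noncomputable def dim (X : Type u) [NormedAddCommGroup X] [NormedSpace ℝ X] : Cardinal.{u} :=
  sInf {c : Cardinal.{u} | ∃ S : Set X, (Submodule.span ℝ S).topologicalClosure = ⊤ ∧
    Cardinal.mk S = c}

/-- `Y` is finitely representable in `X`: for every `ε > 0`, every finite-dimensional subspace of
`Y` is `(1 + ε)`-isomorphic to a subspace of `X`. -/
def FinitelyRepresentable (Y X : Type*) [NormedAddCommGroup Y] [NormedSpace ℝ Y]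
    [NormedAddCommGroup X] [NormedSpace ℝ X] : Prop :=
  ∀ ε : ℝ, 0 < ε → ∀ A : Submodule ℝ Y, FiniteDimensional ℝ A →
    ∃ T : A →L[ℝ] X, HasDistortionLE (1 + ε) T

/-- `Y` is finitely equivalent to `X`, that is, `Y` belongs to the class `X^f`. -/
def FinitelyEquivalent (Y X : Type*) [NormedAddCommGroup Y] [NormedSpace ℝ Y]
    [NormedAddCommGroup X] [NormedSpace ℝ X] : Prop :=
  FinitelyRepresentable Y X ∧ FinitelyRepresentable X Y

/-- `X` is an envelope (of its class `X^f`): every Banach space `Y` that is finitely representable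
in `X` and has `dim Y ≤ dim X` is isometric to a subspace of `X`. -/
def IsEnvelope (X : Type u) [NormedAddCommGroup X] [NormedSpace ℝ X] : Prop :=
  ∀ (Y : Type u) [NormedAddCommGroup Y] [NormedSpace ℝ Y] [CompleteSpace Y],
    FinitelyRepresentable Y X → dim Y ≤ dim X → Nonempty (Y →ₗᵢ[ℝ] X)

/-- `X` is of almost universal disposition with respect to the class `𝒦` of Banach spaces: for
`A ↪ B` in `𝒦` and `ε > 0`, every isomorphic embedding `i : A → X` has an extension to an
isomorphic embedding `i' : B → X` with `‖i'‖ * ‖i'⁻¹‖ ≤ (1 + ε) * ‖i‖ * ‖i⁻¹‖`. Here `K` is any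
upper bound for `‖i‖ * ‖i⁻¹‖`; the bound `1 ≤ K` matters only for `A = 0`. -/
def IsAlmostUniversalDisposition (X : Type u) [NormedAddCommGroup X] [NormedSpace ℝ X]
    (𝒦 : (Y : Type u) → [NormedAddCommGroup Y] → [NormedSpace ℝ Y] → Prop) : Prop :=
  ∀ (A B : Type u) [NormedAddCommGroup A] [NormedSpace ℝ A] [CompleteSpace A]
    [NormedAddCommGroup B] [NormedSpace ℝ B] [CompleteSpace B],
    𝒦 A → 𝒦 B → ∀ (j : A →ₗᵢ[ℝ] B) (ε : ℝ), 0 < ε →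
      ∀ (K : ℝ), 1 ≤ K → ∀ i : A →L[ℝ] X, HasDistortionLE K i →
        ∃ i' : B →L[ℝ] X, (∀ a : A, i' (j a) = i a) ∧ HasDistortionLE ((1 + ε) * K) i'

/-- The (weaker) isometric variant of almost universal disposition: only isometric embeddings
`i : A → X` are required to have extensions `i' : B → X`, with `‖i'‖ * ‖i'⁻¹‖ ≤ 1 + ε`. -/
def IsIsometricAlmostUniversalDisposition (X : Type u) [NormedAddCommGroup X] [NormedSpace ℝ X]
    (𝒦 : (Y : Type u) → [NormedAddCommGroup Y] → [NormedSpace ℝ Y] → Prop) : Prop :=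
  ∀ (A B : Type u) [NormedAddCommGroup A] [NormedSpace ℝ A] [CompleteSpace A]
    [NormedAddCommGroup B] [NormedSpace ℝ B] [CompleteSpace B],
    𝒦 A → 𝒦 B → ∀ (j : A →ₗᵢ[ℝ] B) (ε : ℝ), 0 < ε →
      ∀ i : A →ₗᵢ[ℝ] X,
        ∃ i' : B →L[ℝ] X, (∀ a : A, i' (j a) = i a) ∧ HasDistortionLE (1 + ε) i'

/-- The class of all spaces finitely representable in `X` of dimension strictly less
than `dim X`. -/
def SmallClass (X : Type u) [NormedAddCommGroup X] [NormedSpace ℝ X]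
    (Y : Type u) [NormedAddCommGroup Y] [NormedSpace ℝ Y] : Prop :=
  FinitelyRepresentable Y X ∧ dim Y < dim X

/-- `X` is `f`-saturated: it is of almost universal disposition with respect to the class of all
Banach spaces `Y` finitely representable in `X` with `dim Y < dim X`. -/
def IsFSaturated (X : Type u) [NormedAddCommGroup X] [NormedSpace ℝ X] : Prop :=
  IsAlmostUniversalDisposition X (fun Y _ _ => SmallClass X Y)

/-- The (weaker) isometric variant of `f`-saturation. -/
def IsIsometricallyFSaturated (X : Type u) [NormedAddCommGroup X] [NormedSpace ℝ X] : Prop :=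
  IsIsometricAlmostUniversalDisposition X (fun Y _ _ => SmallClass X Y)

theorem IsFSaturated.isIsometricallyFSaturated {X : Type u} [NormedAddCommGroup X]
    [NormedSpace ℝ X] (h : IsFSaturated X) : IsIsometricallyFSaturated X := by
  intro A B _ _ _ _ _ _ hA hB j ε hε i
  obtain ⟨i', h1, h2⟩ := h A B hA hB j ε hε 1 le_rfl i.toContinuousLinearMap
    ⟨1, one_pos, fun y => by simp⟩
  exact ⟨i', h1, by simpa using h2⟩

/-- `X` is stable (Krivine, Maurey): for all bounded sequences `x`, `y` and ultrafilters `D`, `E`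
over `ℕ`, the iterated limits `lim_D lim_E ‖x n + y m‖` and `lim_E lim_D ‖x n + y m‖` agree. -/
def IsStable (X : Type*) [NormedAddCommGroup X] : Prop :=
  ∀ x y : ℕ → X, (∃ C : ℝ, ∀ n, ‖x n‖ ≤ C ∧ ‖y n‖ ≤ C) → ∀ D E : Ultrafilter ℕ,
    ∃ (f g : ℕ → ℝ) (l : ℝ),
      (∀ n, Tendsto (fun m => ‖x n + y m‖) E (𝓝 (f n))) ∧ Tendsto f D (𝓝 l) ∧
      (∀ m, Tendsto (fun n => ‖x n + y m‖) D (𝓝 (g m))) ∧ Tendsto g E (𝓝 l)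

/-- The subspace of those bounded families whose norms tend to `0` along the ultrafilter `D`. -/
def ultrapowerNull {ι : Type*} (D : Ultrafilter ι) (X : Type*) [NormedAddCommGroup X]
    [NormedSpace ℝ X] : Submodule ℝ (lp (fun _ : ι => X) ∞) where
  carrier := {f | Tendsto (fun i => ‖f i‖) D (𝓝 0)}
  zero_mem' := by simp
  add_mem' := by
    intro f g hf hg
    have h := Tendsto.add (show Tendsto (fun i => ‖f i‖) D (𝓝 0) from hf)
      (show Tendsto (fun i => ‖g i‖) D (𝓝 0) from hg)
    rw [add_zero] at h
    exact squeeze_zero (fun i => norm_nonneg _) (fun i => norm_add_le (f i) (g i)) h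
  smul_mem' := by
    intro c f hf
    have h := Tendsto.const_mul ‖c‖ (show Tendsto (fun i => ‖f i‖) D (𝓝 0) from hf)
    rw [mul_zero] at h
    exact squeeze_zero (fun i => norm_nonneg _) (fun i => (norm_smul c (f i)).le) h

instance isClosed_ultrapowerNull {ι : Type*} (D : Ultrafilter ι) (X : Type*)
    [NormedAddCommGroup X] [NormedSpace ℝ X] :
    IsClosed ((ultrapowerNull D X : Submodule ℝ (lp (fun _ : ι => X) ∞)) :
      Set (lp (fun _ : ι => X) ∞)) := by
  refine isClosed_of_closure_subset fun f hf => ?_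
  rw [Metric.mem_closure_iff] at hf
  change Tendsto (fun i => ‖f i‖) D (𝓝 0)
  rw [Metric.tendsto_nhds]
  intro ε hε
  obtain ⟨g, hg, hfg⟩ := hf (ε / 2) (half_pos hε)
  have hg' : Tendsto (fun i => ‖g i‖) D (𝓝 0) := hg
  rw [Metric.tendsto_nhds] at hg'
  filter_upwards [hg' (ε / 2) (half_pos hε)] with i hi
  rw [Real.dist_eq, sub_zero, abs_norm] at hi ⊢
  have h1 : ‖(f - g) i‖ ≤ ‖f - g‖ := lp.norm_apply_le_norm (by simp) (f - g) i
  rw [dist_eq_norm] at hfg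
  have h2 : ‖f i‖ ≤ ‖(f - g) i‖ + ‖g i‖ := by
    have := norm_add_le ((f - g) i) (g i)
    simpa using this
  linarith

/-- The ultrapower `(X)_D` of a Banach space: bounded families modulo those that tend to `0`
along `D`, with the quotient norm (which is the limit of the norms along `D`, see
`tendsto_norm_ultrapower`). -/
abbrev Ultrapower {ι : Type*} (D : Ultrafilter ι) (X : Type*) [NormedAddCommGroup X]
    [NormedSpace ℝ X] : Type _ :=
  lp (fun _ : ι => X) ∞ ⧸ ultrapowerNull D X

theorem tendsto_norm_ultrapower {ι : Type*} (D : Ultrafilter ι) (X : Type*)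
    [NormedAddCommGroup X] [NormedSpace ℝ X] (f : lp (fun _ : ι => X) ∞) :
    Tendsto (fun i => ‖f i‖) D (𝓝 ‖(Submodule.Quotient.mk f : Ultrapower D X)‖) := by
  classical
  have hb : ∀ (h : lp (fun _ : ι => X) ∞) i, ‖h i‖ ≤ ‖h‖ :=
    fun h i => lp.norm_apply_le_norm (by simp) h i
  rw [Metric.tendsto_nhds]
  intro ε hε
  have hup : ∀ᶠ i in (D : Filter ι),
      ‖f i‖ < ‖(Submodule.Quotient.mk f : Ultrapower D X)‖ + ε := by
    obtain ⟨g, hg, hgn⟩ := Submodule.Quotient.norm_mk_lt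
      (S := ultrapowerNull D X) (Submodule.Quotient.mk f) (half_pos hε)
    have hm : f - g ∈ ultrapowerNull D X := (Submodule.Quotient.eq _).1 hg.symm
    have hm' : Tendsto (fun i => ‖(f - g) i‖) D (𝓝 0) := hm
    filter_upwards [hm'.eventually (gt_mem_nhds (half_pos hε))] with i hi
    have h1 := hb g i
    have h2 : ‖f i‖ ≤ ‖(f - g) i‖ + ‖g i‖ := by
      simpa using norm_add_le ((f - g) i) (g i)
    linarith
  have hlow : ∀ᶠ i in (D : Filter ι),
      ‖(Submodule.Quotient.mk f : Ultrapower D X)‖ - ε < ‖f i‖ := by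
    by_contra hcon
    rw [← Ultrafilter.eventually_not] at hcon
    have hpos : 0 ≤ ‖(Submodule.Quotient.mk f : Ultrapower D X)‖ - ε := by
      obtain ⟨i, hi⟩ := hcon.exists
      exact (norm_nonneg _).trans (not_lt.1 hi)
    have hmem : Memℓp (fun i => if ‖(Submodule.Quotient.mk f : Ultrapower D X)‖ - ε < ‖f i‖
        then (0 : X) else f i) ∞ := by
      refine memℓp_infty ⟨‖f‖, ?_⟩
      rintro _ ⟨i, rfl⟩
      dsimp only
      split_ifs
      · simp
      · exact hb f i
    let g : lp (fun _ : ι => X) ∞ := ⟨_, hmem⟩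
    have hg : (Submodule.Quotient.mk f : Ultrapower D X) = Submodule.Quotient.mk g := by
      refine (Submodule.Quotient.eq _).2 ?_
      change Tendsto (fun i => ‖(f - g) i‖) D (𝓝 0)
      refine (tendsto_const_nhds (x := (0 : ℝ))).congr' ?_
      filter_upwards [hcon] with i hi
      change (0 : ℝ) = ‖f i - (if ‖(Submodule.Quotient.mk f : Ultrapower D X)‖ - ε < ‖f i‖
        then (0 : X) else f i)‖
      rw [if_neg hi, sub_self, norm_zero]
    have hgn : ‖g‖ ≤ ‖(Submodule.Quotient.mk f : Ultrapower D X)‖ - ε := by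
      refine lp.norm_le_of_forall_le hpos fun i => ?_
      change ‖(if ‖(Submodule.Quotient.mk f : Ultrapower D X)‖ - ε < ‖f i‖
        then (0 : X) else f i)‖ ≤ _
      split_ifs with h
      · simpa using hpos
      · exact not_lt.1 h
    have := Submodule.Quotient.norm_mk_le (ultrapowerNull D X) g
    rw [← hg] at this
    linarith
  filter_upwards [hup, hlow] with i h1 h2
  rw [Real.dist_eq, abs_lt]
  constructor <;> linarith

/-- A Banach space is superstable if each of its ultrapowers is stable. -/
def IsSuperstable (X : Type u) [NormedAddCommGroup X] [NormedSpace ℝ X] : Prop :=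
  ∀ (ι : Type u) (D : Ultrafilter ι), IsStable (Ultrapower D X)

/-- The class `X^f` is superstable if each of its members is. -/
def IsSuperstableClass (X : Type u) [NormedAddCommGroup X] [NormedSpace ℝ X] : Prop :=
  ∀ (Y : Type u) [NormedAddCommGroup Y] [NormedSpace ℝ Y] [CompleteSpace Y],
    FinitelyEquivalent Y X → IsSuperstable Y

end FinEquiv

/-! An isometrically f-saturated space `E` of singular dimension is stable. Cover a dense subspace
of `E` by the spans of fewer than `dim E` small sets `S i` (`exists_small_cover`). Saturation gives
points `a i` almost realizing the type of `(y m)` over `S i` and all `x n`, then one point `e`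
almost realizing the type of `(x n)` over all `a i` and all `y m` (`exists_almost_realization`).
Some `b` in the span of one `S i` is close to `e`, so one iterated limit of `‖x n + y m‖` is close
to `‖e + a i‖`, hence to `‖b + a i‖`, to the limit of `‖b + y m‖`, and to the other iterated limit.

The envelope property carries stability to every Banach space finitely representable in `E`. These
include the ultrapowers of members of the class, so the class would be superstable. -/

namespace FinEquiv

/-! ### Distortion and finite representability -/

section FiniteRepresentability

variable {Y X W : Type*} [NormedAddCommGroup Y] [NormedSpace ℝ Y]
  [NormedAddCommGroup X] [NormedSpace ℝ X] [NormedAddCommGroup W] [NormedSpace ℝ W]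

theorem HasDistortionLE.mono {K K' : ℝ} (hK : K ≤ K') {T : Y →L[ℝ] X}
    (h : HasDistortionLE K T) : HasDistortionLE K' T := by
  obtain ⟨a, ha, h⟩ := h
  refine ⟨a, ha, fun y => ⟨(h y).1, (h y).2.trans ?_⟩⟩
  gcongr

theorem HasDistortionLE.comp {K K' : ℝ} (hK : 0 ≤ K) {S : X →L[ℝ] W} {T : Y →L[ℝ] X}
    (hS : HasDistortionLE K S) (hT : HasDistortionLE K' T) :
    HasDistortionLE (K * K') (S.comp T) := by
  obtain ⟨a, ha, hS⟩ := hS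
  obtain ⟨b, hb, hT⟩ := hT
  refine ⟨a * b, mul_pos ha hb, fun y => ⟨?_, ?_⟩⟩
  · calc a * b * ‖y‖ = a * (b * ‖y‖) := by ring
      _ ≤ a * ‖T y‖ := by gcongr; exact (hT y).1
      _ ≤ _ := (hS _).1
  · calc ‖S (T y)‖ ≤ K * a * ‖T y‖ := (hS _).2
      _ ≤ K * a * (K' * b * ‖y‖) := by gcongr; exact (hT y).2
      _ = _ := by ring

theorem HasDistortionLE.comp_isometry {K : ℝ} {S : X →L[ℝ] W} (hS : HasDistortionLE K S)
    (T : Y →ₗᵢ[ℝ] X) : HasDistortionLE K (S.comp T.toContinuousLinearMap) := by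
  obtain ⟨a, ha, hS⟩ := hS
  exact ⟨a, ha, fun y => by simpa using hS (T y)⟩

theorem FinitelyRepresentable.trans (h₁ : FinitelyRepresentable Y X)
    (h₂ : FinitelyRepresentable X W) : FinitelyRepresentable Y W := by
  intro ε hε A hA
  -- With `δ ≤ 1` and `δ ≤ ε / 3`, `(1 + δ)² ≤ 1 + 3δ ≤ 1 + ε`.
  have hδ : 0 < min 1 (ε / 3) := by positivity
  obtain ⟨T, hT⟩ := h₁ _ hδ A hA
  obtain ⟨S, hS⟩ := h₂ _ hδ (LinearMap.range (T : A →ₗ[ℝ] X)) inferInstance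
  let T' : A →L[ℝ] LinearMap.range (T : A →ₗ[ℝ] X) :=
    T.codRestrict _ fun y => ⟨y, rfl⟩
  have hT' : HasDistortionLE (1 + min 1 (ε / 3)) T' := hT
  refine ⟨S.comp T', (hS.comp (by positivity) hT').mono ?_⟩
  have h1 := min_le_left 1 (ε / 3)
  have h2 := min_le_right 1 (ε / 3)
  nlinarith

theorem FinitelyRepresentable.of_isometry (T : Y →ₗᵢ[ℝ] X) (h : FinitelyRepresentable X W) :
    FinitelyRepresentable Y W := by
  intro ε hε A hA
  obtain ⟨S, hS⟩ := h ε hε (A.map T.toLinearMap) inferInstance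
  let T' : A →ₗᵢ[ℝ] A.map T.toLinearMap :=
    ⟨(T.toLinearMap.comp A.subtype).codRestrict _ fun y => ⟨y, y.2, rfl⟩,
      fun y => T.norm_map y⟩
  exact ⟨S.comp T'.toContinuousLinearMap, hS.comp_isometry T'⟩

theorem FinitelyRepresentable.refl (X : Type*) [NormedAddCommGroup X] [NormedSpace ℝ X] :
    FinitelyRepresentable X X :=
  fun _ hε A _ => ⟨A.subtypeL, 1, one_pos, fun y => ⟨by simp, by
    rw [mul_one]; exact le_mul_of_one_le_left (norm_nonneg _) (by linarith)⟩⟩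

/-- Uniformly bounded operators on a finite-dimensional space whose norms converge pointwise to
the norm of the space are eventually almost isometric. -/
theorem eventually_hasDistortionLE {ι : Type*} {l : Filter ι} [FiniteDimensional ℝ Y]
    (T : ι → Y →ₗ[ℝ] X) {C : ℝ} (hC : ∀ i y, ‖T i y‖ ≤ C * ‖y‖)
    (hT : ∀ y, Tendsto (fun i => ‖T i y‖) l (𝓝 ‖y‖)) {ε : ℝ} (hε : 0 < ε) :
    ∀ᶠ i in l, HasDistortionLE (1 + ε) (LinearMap.toContinuousLinearMap (T i)) := by
  set δ : ℝ := min (1 / 2) (ε / 4)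
  have hδ : 0 < δ := by positivity
  have hδ1 : δ ≤ 1 / 2 := min_le_left _ _
  have hδ2 : δ ≤ ε / 4 := min_le_right _ _
  -- Mesh of a finite net for the unit sphere: moving to a net point costs at most `(|C| + 1) * η =
  -- δ / 2`, and convergence at the net points costs another `δ / 2`.
  set η : ℝ := δ / (2 * (|C| + 1)) with hηdef
  have hη : 0 < η := by positivity
  have hηC : (|C| + 1) * η = δ / 2 := by rw [hηdef]; field_simp
  obtain ⟨t, -, ht⟩ := (isCompact_sphere (0 : Y) 1).elim_finite_subcover_image
    (b := Set.univ) (c := fun y => Metric.ball y η) (fun _ _ => Metric.isOpen_ball)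
    (fun y _ => Set.mem_biUnion (Set.mem_univ y) (Metric.mem_ball_self hη))
  have hev : ∀ᶠ i in l, ∀ y ∈ t, |‖T i y‖ - ‖y‖| < δ / 2 := by
    rw [eventually_all_finite ht.1]
    intro y _
    simpa [Real.dist_eq] using (Metric.tendsto_nhds.1 (hT y)) (δ / 2) (half_pos hδ)
  filter_upwards [hev] with i hi
  have key : ∀ y : Y, ‖y‖ = 1 → 1 - δ ≤ ‖T i y‖ ∧ ‖T i y‖ ≤ 1 + δ := by
    intro y hy
    obtain ⟨z, hz, hyz⟩ := Set.mem_iUnion₂.1 (ht.2 (by simpa using hy))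
    rw [Metric.mem_ball, dist_eq_norm] at hyz
    have h1 := abs_lt.1 (hi z hz)
    have h2 : ‖T i y - T i z‖ ≤ |C| * ‖y - z‖ := by
      rw [← map_sub]
      exact (hC i _).trans (by gcongr; exact le_abs_self C)
    have h3 : |C| * ‖y - z‖ ≤ |C| * η := by gcongr
    have h4 := abs_le.1 (abs_norm_sub_norm_le (T i y) (T i z))
    have h5 := abs_le.1 (abs_norm_sub_norm_le y z)
    constructor <;> nlinarith
  refine ⟨1 - δ, by linarith, fun y => ?_⟩
  rw [LinearMap.coe_toContinuousLinearMap']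
  rcases eq_or_ne y 0 with rfl | hy
  · simp
  have hy' : 0 < ‖y‖ := norm_pos_iff.2 hy
  obtain ⟨h1, h2⟩ := key (‖y‖⁻¹ • y) (by rw [norm_smul, norm_inv, norm_norm]; field_simp)
  rw [map_smul, norm_smul, norm_inv, norm_norm, inv_mul_eq_div] at h1 h2
  rw [le_div_iff₀ hy'] at h1
  rw [div_le_iff₀ hy'] at h2
  refine ⟨h1, h2.trans ?_⟩
  gcongr
  nlinarith

/-! ### Ultrapowers -/

theorem ultrapower_finitelyRepresentable {ι : Type*} (D : Ultrafilter ι) (X : Type*)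
    [NormedAddCommGroup X] [NormedSpace ℝ X] : FinitelyRepresentable (Ultrapower D X) X := by
  intro ε hε A hA
  -- A linear choice of representatives makes the coordinate maps linear. It need not be bounded
  -- globally, since its restriction to the finite-dimensional `A` is.
  obtain ⟨s, hs⟩ := (ultrapowerNull D X).mkQ.exists_rightInverse_of_surjective
    (Submodule.range_mkQ _)
  let s' : A →ₗ[ℝ] lp (fun _ : ι => X) ∞ := s.comp A.subtype
  let T : ι → A →ₗ[ℝ] X := fun i =>
    { toFun := fun y => s' y i
      map_add' := fun y z => by simp
      map_smul' := fun c y => by simp }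
  have hT : ∀ y : A, Tendsto (fun i => ‖T i y‖) D (𝓝 ‖y‖) := by
    intro y
    have h := tendsto_norm_ultrapower D X (s' y)
    have h2 : (Submodule.Quotient.mk (s' y) : Ultrapower D X) = y :=
      LinearMap.congr_fun hs (y : Ultrapower D X)
    rw [h2] at h
    exact h
  obtain ⟨i, hi⟩ := (eventually_hasDistortionLE T
    (C := ‖LinearMap.toContinuousLinearMap s'‖) (fun i y =>
      (lp.norm_apply_le_norm (by simp) (s' y) i).trans
        ((LinearMap.toContinuousLinearMap s').le_opNorm y)) hT hε).exists
  exact ⟨_, hi⟩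

end FiniteRepresentability

/-- The diagonal embedding of a space into its ultrapower. -/
noncomputable def ultrapowerDiag {ι : Type*} (D : Ultrafilter ι) (X : Type*)
    [NormedAddCommGroup X] [NormedSpace ℝ X] : X →ₗᵢ[ℝ] Ultrapower D X where
  toFun x := Submodule.Quotient.mk
    ⟨fun _ => x, memℓp_infty ⟨‖x‖, by rintro _ ⟨i, rfl⟩; exact le_rfl⟩⟩
  map_add' _ _ := rfl
  map_smul' _ _ := rfl
  norm_map' x := by
    refine tendsto_nhds_unique (tendsto_norm_ultrapower D X _) ?_
    exact tendsto_const_nhds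

theorem tendsto_norm_ultrapowerDiag_add {ι : Type*} (D : Ultrafilter ι) {X : Type*}
    [NormedAddCommGroup X] [NormedSpace ℝ X] (b : X) (w : lp (fun _ : ι => X) ∞) :
    Tendsto (fun i => ‖b + w i‖) D
      (𝓝 ‖ultrapowerDiag D X b + (Submodule.Quotient.mk w : Ultrapower D X)‖) := by
  let c : lp (fun _ : ι => X) ∞ :=
    ⟨fun _ => b, memℓp_infty ⟨‖b‖, by rintro _ ⟨i, rfl⟩; exact le_rfl⟩⟩
  have h : ultrapowerDiag D X b + (Submodule.Quotient.mk w : Ultrapower D X) =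
      Submodule.Quotient.mk (c + w) := rfl
  rw [h]
  exact tendsto_norm_ultrapower D X (c + w)

/-! ### Almost realizing types over small sets -/

theorem dim_topologicalClosure_span_le {X : Type u} [NormedAddCommGroup X] [NormedSpace ℝ X]
    (S : Set X) : dim (Submodule.span ℝ S).topologicalClosure ≤ Cardinal.mk S := by
  set A := (Submodule.span ℝ S).topologicalClosure
  have hSA : S ⊆ A := Submodule.subset_span.trans (Submodule.le_topologicalClosure _)
  refine le_trans (b := Cardinal.mk (((↑) : A → X) ⁻¹' S)) (csInf_le' ⟨_, ?_, rfl⟩) ?_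
  · rw [eq_top_iff]
    rintro x -
    have hx : (x : X) ∈ closure (Submodule.span ℝ S : Set X) := x.2
    change x ∈ closure (Submodule.span ℝ (((↑) : A → X) ⁻¹' S) : Set A)
    rw [closure_subtype]
    convert hx using 2
    have h := Submodule.map_span A.subtype (((↑) : A → X) ⁻¹' S)
    have h2 : A.subtype '' (((↑) : A → X) ⁻¹' S) = S :=
      Set.image_preimage_eq_of_subset fun s hs => ⟨⟨s, hSA hs⟩, rfl⟩
    rw [h2] at h
    rw [← h]
    rfl
  · exact Cardinal.mk_preimage_of_injective _ _ Subtype.val_injective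

/-- Along an ultrafilter, a bounded sequence of norms converges. -/
theorem exists_tendsto_norm {ι X : Type*} [NormedAddCommGroup X] (D : Ultrafilter ι)
    {z : ι → X} {C : ℝ} (hz : ∀ i, ‖z i‖ ≤ C) : ∃ l, Tendsto (fun i => ‖z i‖) D (𝓝 l) := by
  obtain ⟨l, -, hl⟩ := (isCompact_Icc (a := (0 : ℝ)) (b := C)).ultrafilter_le_nhds'
    (D.map fun i => ‖z i‖) (by
      rw [Ultrafilter.mem_map]
      exact Filter.univ_mem' fun i => ⟨norm_nonneg _, hz i⟩)
  exact ⟨l, hl⟩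

/-- Distortion ignores scaling; preserving the norm of one nonzero vector fixes the scale, as it
forces `a ≤ 1 ≤ K * a`. -/
theorem HasDistortionLE.bounds_of_isometry_at {Y X : Type*} [NormedAddCommGroup Y]
    [NormedSpace ℝ Y] [NormedAddCommGroup X] [NormedSpace ℝ X] {K : ℝ} (hK : 0 ≤ K)
    {T : Y →L[ℝ] X} (hT : HasDistortionLE K T) {v : Y} (hv : v ≠ 0) (hTv : ‖T v‖ = ‖v‖) (y : Y) :
    ‖T y‖ ≤ K * ‖y‖ ∧ ‖y‖ ≤ K * ‖T y‖ := by
  obtain ⟨a, ha, h⟩ := hT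
  have hv' : 0 < ‖v‖ := norm_pos_iff.2 hv
  have h1 : a ≤ 1 := by
    have := (h v).1
    rw [hTv] at this
    exact le_of_mul_le_mul_right (by linarith) hv'
  have h2 : 1 ≤ K * a := by
    have := (h v).2
    rw [hTv] at this
    exact le_of_mul_le_mul_right (by linarith) hv'
  constructor
  · calc ‖T y‖ ≤ K * a * ‖y‖ := (h y).2
      _ ≤ K * 1 * ‖y‖ := by gcongr
      _ = _ := by ring
  · calc ‖y‖ = 1 * ‖y‖ := by ring
      _ ≤ K * a * ‖y‖ := by gcongr
      _ = K * (a * ‖y‖) := by ring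
      _ ≤ _ := by gcongr; exact (h y).1

/-- In an isometrically `f`-saturated space, the type of an ultrapower element over a small set is
almost realized. -/
theorem IsIsometricallyFSaturated.exists_almost_realization {E : Type u} [NormedAddCommGroup E]
    [NormedSpace ℝ E] [CompleteSpace E] (hE : IsIsometricallyFSaturated E)
    (hdim : Cardinal.aleph0 ≤ dim E) {v : E} (hv : v ≠ 0) {S : Set E}
    (hS : Cardinal.mk S < dim E) (D : Ultrafilter ℕ) {z : ℕ → E} {C : ℝ} (hz : ∀ n, ‖z n‖ ≤ C)
    {ε : ℝ} (hε : 0 < ε) :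
    ∃ e : E, ∀ b ∈ Submodule.span ℝ S, ∀ l, Tendsto (fun n => ‖b + z n‖) D (𝓝 l) →
      ‖b + e‖ ≤ (1 + ε) * l ∧ l ≤ (1 + ε) * ‖b + e‖ := by
  let w : lp (fun _ : ℕ => E) ∞ := ⟨z, memℓp_infty ⟨C, by rintro _ ⟨n, rfl⟩; exact hz n⟩⟩
  let d := ultrapowerDiag D E
  let q : Ultrapower D E := Submodule.Quotient.mk w
  -- Adjoining `v` provides a nonzero vector on which the extension is isometric, even if `S` spans
  -- only `0`.
  let S₁ : Set E := insert v S
  let S₂ : Set (Ultrapower D E) := insert q (d '' S₁)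
  let A := (Submodule.span ℝ S₁).topologicalClosure
  let B := (Submodule.span ℝ S₂).topologicalClosure
  have hS₁ : Cardinal.mk S₁ < dim E :=
    Cardinal.mk_insert_le.trans_lt
      (Cardinal.add_lt_of_lt hdim hS (Cardinal.one_lt_aleph0.trans_le hdim))
  have hS₂ : Cardinal.mk S₂ < dim E :=
    Cardinal.mk_insert_le.trans_lt
      (Cardinal.add_lt_of_lt hdim (Cardinal.mk_image_le.trans_lt hS₁)
        (Cardinal.one_lt_aleph0.trans_le hdim))
  have hdB : ∀ a : A, d a ∈ B := by
    have h1 : Submodule.span ℝ S₁ ≤ B.comap d.toLinearMap := by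
      rw [Submodule.span_le]
      intro s hs
      exact (Submodule.le_topologicalClosure _)
        (Submodule.subset_span (Set.mem_insert_of_mem _ ⟨s, hs, rfl⟩))
    have hcl : IsClosed (B.comap d.toLinearMap : Set E) :=
      (Submodule.isClosed_topologicalClosure (Submodule.span ℝ S₂)).preimage d.continuous
    exact fun a => Submodule.topologicalClosure_minimal _ h1 hcl a.2
  have hqB : q ∈ B :=
    Submodule.le_topologicalClosure _ (Submodule.subset_span (Set.mem_insert _ _))
  have hvA : v ∈ A :=
    Submodule.le_topologicalClosure _ (Submodule.subset_span (Set.mem_insert _ _))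
  let j : A →ₗᵢ[ℝ] B :=
    ⟨(d.toLinearMap.comp A.subtype).codRestrict B hdB, fun a => d.norm_map a⟩
  have : CompleteSpace A :=
    (Submodule.isClosed_topologicalClosure (Submodule.span ℝ S₁)).completeSpace_coe
  have : CompleteSpace B :=
    (Submodule.isClosed_topologicalClosure (Submodule.span ℝ S₂)).completeSpace_coe
  -- The inclusion of `A` in `E` is extended along the diagonal embedding; the image of the class
  -- `q` of `z` is the required point.
  obtain ⟨T, hT, hdist⟩ := hE A B
    ⟨.of_isometry A.subtypeₗᵢ (.refl E), (dim_topologicalClosure_span_le S₁).trans_lt hS₁⟩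
    ⟨.of_isometry B.subtypeₗᵢ (ultrapower_finitelyRepresentable D E),
      (dim_topologicalClosure_span_le S₂).trans_lt hS₂⟩ j ε hε A.subtypeₗᵢ
  refine ⟨T ⟨q, hqB⟩, fun b hb l hl => ?_⟩
  have hbA : b ∈ A := Submodule.le_topologicalClosure _
    (Submodule.span_mono (Set.subset_insert v S) hb)
  let y : B := j ⟨b, hbA⟩ + ⟨q, hqB⟩
  have hTy : T y = b + T ⟨q, hqB⟩ := by
    rw [map_add, hT]; rfl
  have hy : ‖y‖ = l := tendsto_nhds_unique (tendsto_norm_ultrapowerDiag_add D b w) hl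
  have hjv : ‖j ⟨v, hvA⟩‖ = ‖v‖ := d.norm_map v
  have hj : j ⟨v, hvA⟩ ≠ 0 := norm_ne_zero_iff.1 (hjv.trans_ne (norm_ne_zero_iff.2 hv))
  have := hdist.bounds_of_isometry_at (by linarith) hj
    ((congrArg norm (hT ⟨v, hvA⟩)).trans hjv.symm) y
  rwa [hTy, hy] at this

/-! ### Singular dimension and stability -/

/-- A dense subset of a space of singular dimension is covered by few small sets, in such a way
that finite subsets are contained in one of them. -/
theorem exists_small_cover {E : Type u} [NormedAddCommGroup E] [NormedSpace ℝ E]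
    (hκ : (dim E).IsSingular) :
    ∃ (I : Type u) (S : I → Set E), Cardinal.mk I < dim E ∧ (∀ i, Cardinal.mk (S i) < dim E) ∧
      ∀ e : E, ∀ δ > 0, ∃ i, ∃ b ∈ Submodule.span ℝ (S i), ‖b - e‖ < δ := by
  have hne : {c : Cardinal.{u} | ∃ S : Set E, (Submodule.span ℝ S).topologicalClosure = ⊤ ∧
      Cardinal.mk S = c}.Nonempty :=
    ⟨_, Set.univ, by
      rw [Submodule.span_univ]
      exact top_le_iff.1 (Submodule.le_topologicalClosure _), rfl⟩
  obtain ⟨S₀, hS₀, hcard⟩ := csInf_mem hne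
  change Cardinal.mk S₀ = dim E at hcard
  set κ := dim E
  obtain ⟨f⟩ : Nonempty (S₀ ≃ κ.ord.ToType) :=
    Cardinal.eq.1 (hcard.trans (Cardinal.mk_ord_toType κ).symm)
  obtain ⟨I, hI, hIcard⟩ := Order.exists_cof_eq κ.ord.ToType
  rw [Ordinal.cof_toType] at hIcard
  have : Nonempty κ.ord.ToType := Cardinal.mk_ne_zero_iff.1 (by
    rw [Cardinal.mk_ord_toType]; exact hκ.pos.ne')
  have hinf : Cardinal.aleph0 ≤ κ := hκ.aleph0_le
  -- Initial segments of an enumeration in order type `κ.ord`, cut at a cofinal set of size `cof κ <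
  -- κ`. They are closed because cofinality only gives `m ≤ i` for a bound `m` of a finite set.
  refine ⟨I, fun i => Subtype.val '' (f ⁻¹' Set.Iic (i : κ.ord.ToType)),
    hIcard ▸ hκ.cof_ord_lt, fun i => ?_, fun e δ hδ => ?_⟩
  · refine Cardinal.mk_image_le.trans_lt
      ((Cardinal.mk_preimage_of_injective _ _ f.injective).trans_lt ?_)
    have hIio := Cardinal.mk_Iio_lt (i : κ.ord.ToType) (by simp)
    rw [Cardinal.mk_ord_toType] at hIio
    rw [← Set.Iio_insert]
    exact Cardinal.mk_insert_le.trans_lt (Cardinal.add_lt_of_lt hinf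
      hIio (Cardinal.one_lt_aleph0.trans_le hinf))
  · have he : e ∈ closure (Submodule.span ℝ S₀ : Set E) := by
      have : e ∈ (Submodule.span ℝ S₀).topologicalClosure := hS₀ ▸ Submodule.mem_top
      exact this
    obtain ⟨b, hb, hbe⟩ := Metric.mem_closure_iff.1 he δ hδ
    obtain ⟨t, ht, hbt⟩ := Submodule.mem_span_finite_of_mem_span hb
    obtain ⟨m, hm⟩ := (t.attach.image fun s : t => f ⟨s.1, ht s.2⟩).exists_le
    obtain ⟨i, hi, hmi⟩ := hI m
    refine ⟨⟨i, hi⟩, b, Submodule.span_mono ?_ hbt, by rwa [← dist_eq_norm, dist_comm]⟩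
    intro s hs
    exact ⟨⟨s, ht hs⟩, (hm _ (Finset.mem_image.2 ⟨⟨s, hs⟩, Finset.mem_attach _ _, rfl⟩)).trans hmi,
      rfl⟩

/-- One inequality suffices for stability, since the two sequences play symmetric roles. -/
theorem IsIsometricallyFSaturated.iterated_limit_le {E : Type u} [NormedAddCommGroup E]
    [NormedSpace ℝ E] [CompleteSpace E] (hE : IsIsometricallyFSaturated E)
    (hκ : (dim E).IsSingular) {x y : ℕ → E} {C : ℝ} (hx : ∀ n, ‖x n‖ ≤ C) (hy : ∀ n, ‖y n‖ ≤ C)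
    {D D' : Ultrafilter ℕ} {f g : ℕ → ℝ} {l l' : ℝ}
    (hf : ∀ n, Tendsto (fun m => ‖x n + y m‖) D' (𝓝 (f n))) (hl : Tendsto f D (𝓝 l))
    (hg : ∀ m, Tendsto (fun n => ‖x n + y m‖) D (𝓝 (g m))) (hl' : Tendsto g D' (𝓝 l')) :
    l ≤ l' := by
  have hinf := hκ.aleph0_le
  have hunc : Cardinal.aleph0 < dim E :=
    hinf.lt_of_ne fun h => Cardinal.not_isSingular_aleph0 (h ▸ hκ)
  obtain ⟨I, S, hI, hS, hdense⟩ := exists_small_cover hκ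
  obtain ⟨v, hv⟩ : ∃ v : E, v ≠ 0 := by
    by_contra! h
    have : dim E ≤ 0 := csInf_le' ⟨∅, by
      rw [eq_top_iff]
      rintro e -
      rw [h e]
      exact Submodule.zero_mem _, by simp⟩
    exact absurd this (not_le.2 hκ.pos)
  have hrange : ∀ z : ℕ → E, Cardinal.mk (Set.range z) < dim E := fun z =>
    (Cardinal.mk_le_aleph0_iff.2 (Set.countable_range z).to_subtype).trans_lt hunc
  -- Each of the four uses of almost realization costs a factor `1 + ε`; passing from `e` to `b` and
  -- back costs `ε` each time.
  have key : ∀ ε > 0, l ≤ (1 + ε) ^ 2 * ((1 + ε) * ((1 + ε) * l' + ε) + ε) := by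
    intro ε hε
    have hpos : 0 < 1 + ε := by linarith
    have hreal : ∀ i, ∃ a : E, ∀ b ∈ Submodule.span ℝ (S i ∪ Set.range x), ∀ r,
        Tendsto (fun n => ‖b + y n‖) D' (𝓝 r) →
          ‖b + a‖ ≤ (1 + ε) * r ∧ r ≤ (1 + ε) * ‖b + a‖ := fun i =>
      hE.exists_almost_realization hinf hv ((Cardinal.mk_union_le _ _).trans_lt
        (Cardinal.add_lt_of_lt hinf (hS i) (hrange x))) D' hy hε
    choose a ha using hreal
    -- All `a i` come before `e`: singularity keeps their number below `dim E`, and the index `i`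
    -- that fits `e` is found only afterwards.
    obtain ⟨e, he⟩ := hE.exists_almost_realization hinf hv
      (S := Set.range a ∪ Set.range y) ((Cardinal.mk_union_le _ _).trans_lt
        (Cardinal.add_lt_of_lt hinf (Cardinal.mk_range_le.trans_lt hI) (hrange y))) D hx hε
    obtain ⟨i, b, hb, hbe⟩ := hdense e ε hε
    obtain ⟨h, hh⟩ := exists_tendsto_norm D (z := fun n => a i + x n) (C := ‖a i‖ + C)
      fun n => (norm_add_le _ _).trans (by gcongr; exact hx n)
    obtain ⟨p, hp⟩ := exists_tendsto_norm D' (z := fun m => e + y m) (C := ‖e‖ + C)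
      fun n => (norm_add_le _ _).trans (by gcongr; exact hy n)
    obtain ⟨q, hq⟩ := exists_tendsto_norm D' (z := fun m => b + y m) (C := ‖b‖ + C)
      fun n => (norm_add_le _ _).trans (by gcongr; exact hy n)
    have h1 : l ≤ (1 + ε) * h := by
      refine le_of_tendsto_of_tendsto' hl (hh.const_mul (1 + ε)) fun n => ?_
      have := (ha i (x n) (Submodule.subset_span (Or.inr ⟨n, rfl⟩)) _ (hf n)).2
      rwa [add_comm (x n)] at this
    have h2 : h ≤ (1 + ε) * ‖a i + e‖ :=
      (he (a i) (Submodule.subset_span (Or.inl ⟨i, rfl⟩)) _ hh).2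
    have h3 : ‖a i + e‖ ≤ ‖b + a i‖ + ε := by
      have h := norm_sub_le (b + a i) (b - e)
      rw [show b + a i - (b - e) = a i + e by abel] at h
      linarith
    have h4 : ‖b + a i‖ ≤ (1 + ε) * q :=
      (ha i b (Submodule.span_mono Set.subset_union_left hb) _ hq).1
    have h5 : q ≤ p + ε := by
      refine le_of_tendsto_of_tendsto' hq (hp.add_const ε) fun m => ?_
      have h := norm_add_le (e + y m) (b - e)
      rw [show e + y m + (b - e) = b + y m by abel] at h
      linarith
    have h6 : p ≤ (1 + ε) * l' := by
      refine le_of_tendsto_of_tendsto' hp (hl'.const_mul (1 + ε)) fun m => ?_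
      have := (he (y m) (Submodule.subset_span (Or.inr ⟨m, rfl⟩)) (g m)
        (by simpa only [add_comm (y m)] using hg m)).1
      rwa [add_comm (y m)] at this
    calc l ≤ (1 + ε) * ((1 + ε) * ‖a i + e‖) := h1.trans (by gcongr)
      _ ≤ (1 + ε) * ((1 + ε) * ((1 + ε) * ((1 + ε) * l' + ε) + ε)) := by
        gcongr
        exact h3.trans (by gcongr; exact h4.trans (by gcongr; linarith))
      _ = _ := by ring
  have hcont : Continuous fun ε : ℝ => (1 + ε) ^ 2 * ((1 + ε) * ((1 + ε) * l' + ε) + ε) := by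
    fun_prop
  have hlim := (hcont.tendsto 0).mono_left (nhdsWithin_le_nhds (s := Set.Ioi 0))
  have := ge_of_tendsto hlim (eventually_mem_nhdsWithin.mono key)
  simpa using this

theorem IsIsometricallyFSaturated.isStable {E : Type u} [NormedAddCommGroup E]
    [NormedSpace ℝ E] [CompleteSpace E] (hE : IsIsometricallyFSaturated E)
    (hκ : (dim E).IsSingular) : IsStable E := by
  rintro x y ⟨C, hC⟩ D D'
  have hxy : ∀ n m, ‖x n + y m‖ ≤ C + C := fun n m =>
    (norm_add_le _ _).trans (add_le_add (hC n).1 (hC m).2)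
  choose f hf using fun n => exists_tendsto_norm D' (hxy n)
  choose g hg using fun m => exists_tendsto_norm D fun n => hxy n m
  have hf0 : ∀ n, 0 ≤ f n := fun n => ge_of_tendsto' (hf n) fun _ => norm_nonneg _
  have hg0 : ∀ n, 0 ≤ g n := fun n => ge_of_tendsto' (hg n) fun _ => norm_nonneg _
  obtain ⟨l, hl⟩ := exists_tendsto_norm D (z := f) (C := C + C) fun n => by
    rw [Real.norm_of_nonneg (hf0 n)]
    exact le_of_tendsto' (hf n) (hxy n)
  obtain ⟨l', hl'⟩ := exists_tendsto_norm D' (z := g) (C := C + C) fun m => by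
    rw [Real.norm_of_nonneg (hg0 m)]
    exact le_of_tendsto' (hg m) fun n => hxy n m
  simp only [Real.norm_of_nonneg (hf0 _)] at hl
  simp only [Real.norm_of_nonneg (hg0 _)] at hl'
  have h : l = l' := le_antisymm
    (hE.iterated_limit_le hκ (fun n => (hC n).1) (fun n => (hC n).2) hf hl hg hl')
    (hE.iterated_limit_le hκ (fun n => (hC n).2) (fun n => (hC n).1)
      (by simpa only [add_comm] using hg) hl' (by simpa only [add_comm] using hf) hl)
  exact ⟨f, g, l, hf, hl, hg, h ▸ hl'⟩

/-! ### Transfer of stability through the envelope -/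

/-- Stability of an envelope passes to all spaces finitely representable in it. -/
theorem IsEnvelope.isStable_of_finitelyRepresentable {E : Type u} [NormedAddCommGroup E]
    [NormedSpace ℝ E] (hE : IsEnvelope E) (hdim : Cardinal.aleph0 ≤ dim E) (hst : IsStable E)
    {Z : Type u} [NormedAddCommGroup Z] [NormedSpace ℝ Z] [CompleteSpace Z]
    (hZ : FinitelyRepresentable Z E) : IsStable Z := by
  rintro x y ⟨C, hC⟩ D D'
  -- Stability concerns two sequences at a time, so only a separable subspace has to embed in `E`,
  -- whatever the size of `Z`.
  let S : Set Z := Set.range x ∪ Set.range y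
  let A := (Submodule.span ℝ S).topologicalClosure
  have : CompleteSpace A :=
    (Submodule.isClosed_topologicalClosure (Submodule.span ℝ S)).completeSpace_coe
  have hSA : S ⊆ A := Submodule.subset_span.trans (Submodule.le_topologicalClosure _)
  obtain ⟨T⟩ := hE A (.of_isometry A.subtypeₗᵢ hZ)
    ((dim_topologicalClosure_span_le S).trans ((Cardinal.mk_le_aleph0_iff.2
      ((Set.countable_range x).union (Set.countable_range y)).to_subtype).trans hdim))
  let x' : ℕ → A := fun n => ⟨x n, hSA (Or.inl ⟨n, rfl⟩)⟩
  let y' : ℕ → A := fun n => ⟨y n, hSA (Or.inr ⟨n, rfl⟩)⟩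
  have h := hst (fun n => T (x' n)) (fun n => T (y' n))
    ⟨C, fun n => by simp only [T.norm_map]; exact hC n⟩ D D'
  simp only [← map_add, T.norm_map] at h
  exact h

end FinEquiv

theorem mainTheorem12 (E : Type u) [NormedAddCommGroup E] [NormedSpace ℝ E] [CompleteSpace E]
    (hE : FinEquiv.IsEnvelope E) (hstab : ¬ FinEquiv.IsSuperstableClass E)
    (κ : Cardinal.{u}) (hdim : FinEquiv.dim E = κ) (hκ : κ.IsSingular) :
    ¬ FinEquiv.IsFSaturated E ∧ ¬ FinEquiv.IsIsometricallyFSaturated E := by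
  subst hdim
  have h : ¬ FinEquiv.IsIsometricallyFSaturated E := fun hsat =>
    hstab fun Y _ _ _ hY ι D =>
      hE.isStable_of_finitelyRepresentable hκ.aleph0_le (hsat.isStable hκ)
        ((FinEquiv.ultrapower_finitelyRepresentable D Y).trans hY.1)
  exact ⟨fun hsat => h hsat.isIsometricallyFSaturated, h⟩
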